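/- Let $\mathcal X,\mathcal Y,\mathcal Z$ be finite alphabets and let $\mathcal S$ be a set of states. Consider a state-dependent source with a degraded eavesdropper, $p(x,y,z\mid s_{ab},s_e)=p(x,y\mid s_{ab})\,p(z\mid y,s_{ab},s_e)$. Fix a state pair $(s_{ab},s_e)$ and let $(X_i,Y_i,Z_i)_{i\le n}$ be i.i.d. with law $p(\cdot\mid s_{ab},s_e)$; Alice sees $X^n$, Bob sees $Y^n$, Eve sees $Z^n$. All probabilities and information measures below (logarithms to base $2$) are conditional on the state pair. Let $$C_s=I(X;Y\mid s_{ab})-I(X;Z\mid s_{ab},s_e),\qquad R\ge 0,\qquad R_e=R-C_s .$$ A one-way key generation scheme with key set $[1:2^{nR}]$ consists, for each block length $n$, of a key $K=f_1(X^n,s_{ab})\in[1:2^{nR}]$, a public message $\Phi=g(X^n,s_{ab})\in[1:2^{nR_\phi}]$ (for some $R_\phi$ not depending on $n$) and Bob's key $\hat K=f_2(Y^n,s_{ab},\Phi)$. Say that Bob reliably recovers $X^n$ if there are decoders $d_n$ with $\Pr\big(X^n\ne d_n(Y^n,s_{ab},\Phi)\big)\to0$ as $n\to\infty$. Let $\epsilon>0$,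 and call a scheme $\epsilon$-rate-$R$ if $\frac1nH(K)>R-\epsilon$ for all sufficiently large $n$. Suppose that $R_e>0$ and take any $\epsilon$-rate-$R$ scheme for which Bob reliably recovers $X^n$. Then: (i) for all sufficiently large $n$, this scheme satisfies $\frac1n I(K;Z^n,\Phi\mid s_{ab},s_e)\ \ge\ R_e-2\epsilon$; (ii) there exists a scheme with key set $[1:2^{nR}]$, for which Bob reliably recovers $X^n$, such that for all sufficiently large $n$ $$\Pr(K\neq\hat K)<\epsilon,\qquad \tfrac1nH(K)>R-\epsilon,\qquad \tfrac1n I(K;Z^n,\Phi\mid s_{ab},s_e)\le R_e+2\epsilon .$$ Consequently $R>C_s$ characterizes secrecy outage: for every $R\ge0$ one has $R>C_s$ if and only if there are $r>0$ and $\epsilon>0$ such that every $\epsilon$-rate-$R$ scheme for which Bob reliably recovers $X^n$ satisfies $\frac1n I(K;Z^n,\Phi\mid s_{ab},s_e)>r$ for all sufficiently large $n$. -/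

import Mathlib

open Filter Topology

noncomputable section

namespace KeyLeak

/-! ### Finite probability and information measures (logarithms to base 2) -/

open Classical in
/-- Probability of the event `E` under the probability mass function `p` on a finite set. -/
def prob {Ω : Type*} [Fintype Ω] (p : Ω → ℝ) (E : Ω → Prop) : ℝ :=
  ∑ ω, if E ω then p ω else 0

/-- Shannon entropy `H(A)`, in bits, of the random variable `A` under `p`. -/
def entropy {Ω α : Type*} [Fintype Ω] [Fintype α] (p : Ω → ℝ) (A : Ω → α) : ℝ :=
  (∑ a, Real.negMulLog (prob p (fun ω => A ω = a))) / Real.log 2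

/-- Mutual information `I(A;B) = H(A) + H(B) - H(A,B)`, in bits. -/
def mutualInfo {Ω α β : Type*} [Fintype Ω] [Fintype α] [Fintype β]
    (p : Ω → ℝ) (A : Ω → α) (B : Ω → β) : ℝ :=
  entropy p A + entropy p B - entropy p (fun ω => (A ω, B ω))

/-! ### The source -/

/-- A state-dependent discrete source with a degraded eavesdropper:
`p(x,y,z | s_ab,s_e) = p(x,y | s_ab) * p(z | y,s_ab,s_e)`, with `main s_ab (x, y) = p(x,y | s_ab)`
and `eve s_ab s_e y z = p(z | y,s_ab,s_e)`. -/
structure DegradedSource (S X Y Z : Type*) [Fintype X] [Fintype Y] [Fintype Z] where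
  main : S → X × Y → ℝ
  eve : S → S → Y → Z → ℝ
  main_mem : ∀ s, main s ∈ stdSimplex ℝ (X × Y)
  eve_mem : ∀ s t y, eve s t y ∈ stdSimplex ℝ Z

section
variable {S X Y Z : Type*} [Fintype X] [Fintype Y] [Fintype Z]

/-- The single-letter law `p(x,y,z | s_ab,s_e)`. -/
def DegradedSource.law (P : DegradedSource S X Y Z) (sab se : S) : X × Y × Z → ℝ :=
  fun w => P.main sab (w.1, w.2.1) * P.eve sab se w.2.1 w.2.2

/-- The law of the memoryless block `(X^n, Y^n, Z^n)` given the (constant) state pair. -/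
def DegradedSource.blockLaw (P : DegradedSource S X Y Z) (sab se : S) (n : ℕ) :
    (Fin n → X × Y × Z) → ℝ :=
  fun ω => ∏ i, P.law sab se (ω i)

/-- The conditional secret key capacity `C_s = I(X;Y | s_ab) - I(X;Z | s_ab,s_e)`. -/
def DegradedSource.Cs (P : DegradedSource S X Y Z) (sab se : S) : ℝ :=
  mutualInfo (P.main sab) (fun w => w.1) (fun w => w.2)
    - mutualInfo (P.law sab se) (fun w => w.1) (fun w => w.2.2)

end

/-- The observation blocks: `obsX` is `X^n` (Alice), `obsY` is `Y^n` (Bob), `obsZ` is `Z^n` (Eve). -/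
def obsX {X Y Z : Type*} {n : ℕ} (ω : Fin n → X × Y × Z) : Fin n → X := fun i => (ω i).1

/-- See `obsX`. -/
def obsY {X Y Z : Type*} {n : ℕ} (ω : Fin n → X × Y × Z) : Fin n → Y := fun i => (ω i).2.1

/-- See `obsX`. -/
def obsZ {X Y Z : Type*} {n : ℕ} (ω : Fin n → X × Y × Z) : Fin n → Z := fun i => (ω i).2.2

/-! ### The one-way key generation protocol -/

/-- The index set `[1 : 2^(n r)]`. -/
abbrev Index (n : ℕ) (r : ℝ) : Type := Fin ⌊(2 : ℝ) ^ ((n : ℝ) * r)⌋₊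

/-- A one-way discussion key generation system of block length `n`, with key set `[1 : 2^(n R)]` and
public message set `[1 : 2^(n Rφ)]`: Alice's key `f₁(X^n, s_ab)`, her public message `g(X^n, s_ab)`
and Bob's key `f₂(Y^n, s_ab, φ)`. -/
structure KeySystem (S X Y : Type*) (R Rφ : ℝ) (n : ℕ) where
  f₁ : (Fin n → X) → S → Index n R
  g : (Fin n → X) → S → Index n Rφ
  f₂ : (Fin n → Y) → S → Index n Rφ → Index n R

section
variable {S X Y Z : Type*} [Fintype X] [Fintype Y] [Fintype Z]

/-- `Pr(K ≠ K̂ | s_ab,s_e)`. -/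
def keyError (P : DegradedSource S X Y Z) (sab se : S) {R Rφ : ℝ} {n : ℕ}
    (c : KeySystem S X Y R Rφ n) : ℝ :=
  prob (P.blockLaw sab se n)
    (fun ω => c.f₁ (obsX ω) sab ≠ c.f₂ (obsY ω) sab (c.g (obsX ω) sab))

/-- The normalized key entropy `(1/n) H(K | s_ab,s_e)`. -/
def keyRate (P : DegradedSource S X Y Z) (sab se : S) {R Rφ : ℝ} {n : ℕ}
    (c : KeySystem S X Y R Rφ n) : ℝ :=
  entropy (P.blockLaw sab se n) (fun ω => c.f₁ (obsX ω) sab) / n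

/-- The normalized leakage `(1/n) I(K; Z^n, Φ | s_ab,s_e)`. -/
def leakage (P : DegradedSource S X Y Z) (sab se : S) {R Rφ : ℝ} {n : ℕ}
    (c : KeySystem S X Y R Rφ n) : ℝ :=
  mutualInfo (P.blockLaw sab se n) (fun ω => c.f₁ (obsX ω) sab)
    (fun ω => (obsZ ω, c.g (obsX ω) sab)) / n

/-- Bob can reliably recover `X^n`: for some decoders `d`,
`Pr(X^n ≠ d(Y^n, s_ab, φ) | s_ab,s_e) → 0` as `n → ∞`. -/
def RecoversSource (P : DegradedSource S X Y Z) (sab se : S) {R Rφ : ℝ}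
    (c : ∀ n, KeySystem S X Y R Rφ n) : Prop :=
  ∃ d : ∀ n : ℕ, (Fin n → Y) → S → Index n Rφ → (Fin n → X),
    Tendsto (fun n => prob (P.blockLaw sab se n)
      (fun ω => obsX ω ≠ d n (obsY ω) sab ((c n).g (obsX ω) sab))) atTop (𝓝 0)

end

end KeyLeak

end

/-!
Everything rests on two facts about `p(· | s_ab, s_e)`: the identity `C_s = H(X|Z) - H(X|Y)` and,
because of degradedness, `C_s = I(X;Y|Z)`.

Lower bound on the leakage. As `K` is a function of `X^n`, `H(K | Z^n, Φ) ≤ H(X^n | Z^n, Φ)`, and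
this is `I(X^n; Y^n | Z^n, Φ) + H(X^n | Y^n, Z^n, Φ)`. The first term is at most
`I(X^n; Y^n | Z^n) = n C_s` since `Φ` is a function of `X^n`; the second is `o(n)` by Fano's
inequality, since Bob recovers `X^n`. Hence the leakage `H(K) - H(K | Z^n, Φ)` is at least
`H(K) - n C_s - o(n)` (`key_entropy_sub_le_mutualInfo`, `eventually_le_leakage`).

Schemes. Bin `X^n` at random, independently, into a message `Φ` of rate `H(X|Y) + η`, the key `K`
of rate `R`, and two auxiliary indices `J₁`, `J₂`, which are never transmitted, of rates
`max (C_s - R) 0 + η` and `max (H(X) - R) 0 + η`. By the Slepian–Wolf theorem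
(`exists_slepianWolf`), applied to the three decoding problems at once (`exists_binning`), some
choice of binnings makes `X^n` recoverable from `(Y^n, Φ)`, from `(Z^n, Φ, K, J₁)` and from
`(K, J₂)`. By Fano's inequality the last property gives `H(K) ≥ n H(X) - H(J₂) - o(n)`, which is
about `n min R H(X)`, and the second one gives
`I(K; Z^n, Φ) ≤ H(K) + H(Φ) + H(J₁) - n H(X|Z) + o(n)`, which is about `n max (R - C_s) 0`
(`exists_scheme`). For `R > C_s` this is the upper bound on the leakage, and for `R ≤ C_s` it shows
that no positive leakage rate is forced.

All entropy inequalities come from Gibbs' inequality, and typicality in the binning argument is a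
Chernoff bound for sums over a memoryless block.
-/

namespace KeyLeak

/-! ### Entropy inequalities on a finite probability space -/

section Entropy

variable {Ω α β γ : Type*} [Fintype Ω] [Fintype α] [Fintype β] [Fintype γ] {p : Ω → ℝ}

lemma prob_eq_sum (p : Ω → ℝ) (E : Ω → Prop) [DecidablePred E] :
    prob p E = ∑ ω, if E ω then p ω else 0 := by
  unfold prob
  congr!

lemma prob_nonneg (hp : ∀ ω, 0 ≤ p ω) (E : Ω → Prop) : 0 ≤ prob p E :=
  Finset.sum_nonneg fun ω _ => by split_ifs <;> simp [hp]

lemma prob_mono (hp : ∀ ω, 0 ≤ p ω) {E F : Ω → Prop} (h : ∀ ω, 0 < p ω → E ω → F ω) :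
    prob p E ≤ prob p F := by
  refine Finset.sum_le_sum fun ω _ => ?_
  rcases (hp ω).eq_or_lt with h0 | h0
  · simp [← h0]
  · by_cases hE : E ω
    · simp [hE, h ω h0 hE]
    · simp only [hE, if_false]
      split_ifs <;> simp [hp]

lemma le_prob (hp : ∀ ω, 0 ≤ p ω) {E : Ω → Prop} {ω : Ω} (h : E ω) : p ω ≤ prob p E := by
  classical
  have := Finset.single_le_sum (f := fun ω => if E ω then p ω else 0)
    (fun ω _ => by split_ifs <;> simp [hp]) (Finset.mem_univ ω)
  simp only [h, if_true] at this
  unfold prob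
  convert this

lemma prob_self_pos {δ : Type*} (hp : ∀ ω, 0 ≤ p ω) (A : Ω → δ) {ω : Ω} (h : 0 < p ω) :
    0 < prob p (fun ω' => A ω' = A ω) :=
  h.trans_le (le_prob hp rfl)

/-- The expectation of a function of `A`, computed with the law of `A`. -/
lemma sum_prob_mul (p : Ω → ℝ) (A : Ω → α) (f : α → ℝ) :
    ∑ a, prob p (fun ω => A ω = a) * f a = ∑ ω, p ω * f (A ω) := by
  classical
  simp only [prob, Finset.sum_mul, ite_mul, zero_mul]
  rw [Finset.sum_comm]
  refine Finset.sum_congr rfl fun ω _ => ?_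
  rw [Finset.sum_eq_single (A ω)] <;> simp +contextual [eq_comm]

lemma sum_prob (p : Ω → ℝ) (A : Ω → α) : ∑ a, prob p (fun ω => A ω = a) = ∑ ω, p ω := by
  simpa using sum_prob_mul p A (fun _ => 1)

lemma sum_prob_pair {δ : Type*} (p : Ω → ℝ) (A : Ω → α) (B : Ω → δ) (b : δ) :
    ∑ a, prob p (fun ω => (A ω, B ω) = (a, b)) = prob p (fun ω => B ω = b) := by
  classical
  simp only [prob]
  rw [Finset.sum_comm]
  refine Finset.sum_congr rfl fun ω _ => ?_
  rw [Finset.sum_eq_single (A ω)] <;> simp +contextual [eq_comm]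

/-- Entropy as the expectation of the self-information. -/
lemma entropy_eq (p : Ω → ℝ) (A : Ω → α) :
    entropy p A = ∑ ω, p ω * -Real.logb 2 (prob p (fun ω' => A ω' = A ω)) := by
  rw [← sum_prob_mul p A (fun a => -Real.logb 2 (prob p (fun ω' => A ω' = a))), entropy,
    Finset.sum_div]
  refine Finset.sum_congr rfl fun a _ => ?_
  rw [Real.negMulLog, Real.logb]
  ring

/-- Gibbs' inequality: the cross-entropy against a subprobability `q` dominates the entropy. -/
lemma entropy_le_crossEntropy (hp : p ∈ stdSimplex ℝ Ω) (A : Ω → α) {q : α → ℝ}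
    (hq0 : ∀ a, 0 ≤ q a) (hq1 : ∑ a, q a ≤ 1) (hpos : ∀ ω, 0 < p ω → 0 < q (A ω)) :
    entropy p A ≤ ∑ ω, p ω * -Real.logb 2 (q (A ω)) := by
  have hl2 : 0 < Real.log 2 := Real.log_pos one_lt_two
  set Q : α → ℝ := fun a => prob p (fun ω' => A ω' = a) with hQ
  have key : ∀ ω, p ω * -Real.logb 2 (Q (A ω)) - p ω * -Real.logb 2 (q (A ω))
      ≤ (p ω * (q (A ω) / Q (A ω)) - p ω) / Real.log 2 := by
    intro ω
    rcases (hp.1 ω).eq_or_lt with h0 | h0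
    · simp [← h0]
    have hQp : 0 < Q (A ω) := prob_self_pos hp.1 A h0
    have h1 := Real.log_le_sub_one_of_pos (div_pos (hpos ω h0) hQp)
    rw [Real.log_div (hpos ω h0).ne' hQp.ne'] at h1
    rw [le_div_iff₀ hl2]
    calc _ = p ω * (Real.log (q (A ω)) - Real.log (Q (A ω))) := by
          simp only [Real.logb]; field_simp; ring
      _ ≤ p ω * (q (A ω) / Q (A ω) - 1) := by gcongr
      _ = _ := by ring
  have hsum : ∑ ω, p ω * (q (A ω) / Q (A ω)) ≤ 1 := by
    rw [← sum_prob_mul p A (fun a => q a / Q a)]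
    refine le_trans (Finset.sum_le_sum fun a _ => ?_) hq1
    by_cases h : Q a = 0
    · simpa [h] using hq0 a
    · exact (mul_div_cancel₀ _ h).le
  rw [entropy_eq, ← sub_nonpos, ← Finset.sum_sub_distrib]
  refine (Finset.sum_le_sum fun ω _ => key ω).trans ?_
  rw [← Finset.sum_div, Finset.sum_sub_distrib, hp.2]
  exact div_nonpos_of_nonpos_of_nonneg (by linarith) hl2.le

/-- Conditional form of Gibbs' inequality: `H(A | B)` is at most the conditional cross-entropy
against a family `q · b` of subprobabilities. -/
lemma condEntropy_le_crossEntropy (hp : p ∈ stdSimplex ℝ Ω) (A : Ω → α) (B : Ω → β)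
    {q : α → β → ℝ} (hq0 : ∀ a b, 0 ≤ q a b) (hq1 : ∀ b, ∑ a, q a b ≤ 1)
    (hpos : ∀ ω, 0 < p ω → 0 < q (A ω) (B ω)) :
    entropy p (fun ω => (A ω, B ω)) ≤ entropy p B + ∑ ω, p ω * -Real.logb 2 (q (A ω) (B ω)) := by
  refine (entropy_le_crossEntropy hp (fun ω => (A ω, B ω))
    (q := fun w => q w.1 w.2 * prob p (fun ω => B ω = w.2))
    (fun w => mul_nonneg (hq0 _ _) (prob_nonneg hp.1 _)) ?_
    fun ω h => mul_pos (hpos ω h) (prob_self_pos hp.1 B h)).trans ?_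
  · rw [Fintype.sum_prod_type_right]
    simp only [← Finset.sum_mul]
    calc _ ≤ ∑ b, 1 * prob p (fun ω => B ω = b) :=
          Finset.sum_le_sum fun b _ => mul_le_mul_of_nonneg_right (hq1 b) (prob_nonneg hp.1 _)
      _ ≤ 1 := by simp [sum_prob, hp.2]
  · rw [entropy_eq p B, ← Finset.sum_add_distrib]
    refine Finset.sum_le_sum fun ω _ => ?_
    rcases (hp.1 ω).eq_or_lt with h0 | h0
    · simp [← h0]
    dsimp only
    rw [Real.logb_mul (hpos ω h0).ne' (prob_self_pos hp.1 B h0).ne']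
    exact le_of_eq (by ring)

/-- Data processing for entropy: a variable determined by `A` has at most the entropy of `A`. -/
lemma entropy_le_of_determined (hp : p ∈ stdSimplex ℝ Ω) {A : Ω → α} {B : Ω → β}
    (h : ∀ ω ω', A ω = A ω' → B ω = B ω') : entropy p B ≤ entropy p A := by
  rw [entropy_eq, entropy_eq]
  refine Finset.sum_le_sum fun ω _ => ?_
  rcases (hp.1 ω).eq_or_lt with h0 | h0
  · simp [← h0]
  refine mul_le_mul_of_nonneg_left (neg_le_neg ?_) h0.le
  exact Real.logb_le_logb_of_le one_lt_two (prob_self_pos hp.1 A h0)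
    (prob_mono hp.1 fun ω' _ h' => h _ _ h')

lemma entropy_eq_of_determined (hp : p ∈ stdSimplex ℝ Ω) {A : Ω → α} {B : Ω → β}
    (h : ∀ ω ω', A ω = A ω' ↔ B ω = B ω') : entropy p B = entropy p A :=
  le_antisymm (entropy_le_of_determined hp fun ω ω' => (h ω ω').1)
    (entropy_le_of_determined hp fun ω ω' => (h ω ω').2)

lemma entropy_pair_le_add_logb_card (hp : p ∈ stdSimplex ℝ Ω) (A : Ω → α) (B : Ω → β) :
    entropy p (fun ω => (A ω, B ω)) ≤ entropy p B + Real.logb 2 (Fintype.card α) := by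
  have hne : ∀ ω : Ω, (0 : ℝ) < Fintype.card α := fun ω => by
    have : Nonempty α := ⟨A ω⟩
    exact_mod_cast Fintype.card_pos
  refine (condEntropy_le_crossEntropy hp A B (q := fun _ _ => (Fintype.card α : ℝ)⁻¹)
    (fun _ _ => by positivity) (fun _ => by simpa using mul_inv_le_one)
    fun ω _ => inv_pos.2 (hne ω)).trans_eq ?_
  simp [Real.logb_inv, ← Finset.sum_mul, hp.2]

lemma entropy_le_logb_card (hp : p ∈ stdSimplex ℝ Ω) (A : Ω → α) :
    entropy p A ≤ Real.logb 2 (Fintype.card α) := by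
  have h1 := entropy_pair_le_add_logb_card hp A (fun _ => ())
  have h2 : entropy p (fun _ => ()) = 0 := by simp [entropy, prob, hp.2]
  have h3 : entropy p A ≤ entropy p (fun ω => (A ω, ())) :=
    entropy_le_of_determined hp fun _ _ h => (Prod.mk.inj h).1
  linarith

/-- Conditioning reduces entropy: `H(A | B, C) ≤ H(A | C)`. -/
lemma entropy_submodular (hp : p ∈ stdSimplex ℝ Ω) (A : Ω → α) (B : Ω → β) (C : Ω → γ) :
    entropy p (fun ω => (A ω, B ω, C ω)) + entropy p C
      ≤ entropy p (fun ω => (A ω, C ω)) + entropy p (fun ω => (B ω, C ω)) := by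
  have h := condEntropy_le_crossEntropy hp A (fun ω => (B ω, C ω))
    (q := fun a w => prob p (fun ω => (A ω, C ω) = (a, w.2)) / prob p (fun ω => C ω = w.2))
    (fun a b => div_nonneg (prob_nonneg hp.1 _) (prob_nonneg hp.1 _))
    (fun b => by rw [← Finset.sum_div, sum_prob_pair]; exact div_self_le_one _)
    (fun ω h0 => div_pos (prob_self_pos hp.1 (fun ω => (A ω, C ω)) h0) (prob_self_pos hp.1 C h0))
  have h2 : ∑ ω, p ω * -Real.logb 2 (prob p (fun ω' => (A ω', C ω') = (A ω, C ω))
      / prob p (fun ω' => C ω' = C ω)) = entropy p (fun ω => (A ω, C ω)) - entropy p C := by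
    rw [entropy_eq p C, entropy_eq p, ← Finset.sum_sub_distrib]
    refine Finset.sum_congr rfl fun ω _ => ?_
    rcases (hp.1 ω).eq_or_lt with h0 | h0
    · simp [← h0]
    rw [Real.logb_div (prob_self_pos hp.1 (fun ω => (A ω, C ω)) h0).ne'
      (prob_self_pos hp.1 C h0).ne']
    ring
  dsimp only at h
  rw [h2] at h
  linarith

lemma entropy_subadditive (hp : p ∈ stdSimplex ℝ Ω) (A : Ω → α) (B : Ω → β) :
    entropy p (fun ω => (A ω, B ω)) ≤ entropy p A + entropy p B := by
  have h1 := entropy_submodular hp A B (fun _ => ())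
  have h2 : entropy p (fun _ => ()) = 0 := by simp [entropy, prob, hp.2]
  have h3 : entropy p (fun ω => (A ω, B ω)) ≤ entropy p (fun ω => (A ω, B ω, ())) :=
    entropy_le_of_determined hp fun _ _ h => by simpa using h
  have h4 : entropy p (fun ω => (A ω, ())) ≤ entropy p A :=
    entropy_le_of_determined hp fun _ _ h => by simpa using h
  have h5 : entropy p (fun ω => (B ω, ())) ≤ entropy p B :=
    entropy_le_of_determined hp fun _ _ h => by simpa using h
  linarith

/-- Fano's inequality, with the binary entropy of the error bounded by one bit. -/
lemma fano (hp : p ∈ stdSimplex ℝ Ω) (A : Ω → α) (B : Ω → β) (d : β → α) :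
    entropy p (fun ω => (A ω, B ω)) ≤ entropy p B + 1
      + prob p (fun ω => A ω ≠ d (B ω)) * Real.logb 2 (Fintype.card α) := by
  classical
  -- Compare with guessing `d b` with probability one half and uniformly otherwise.
  set N : ℝ := (Fintype.card α : ℝ) with hN
  have hne : ∀ ω : Ω, 1 ≤ N := fun ω => by
    have : Nonempty α := ⟨A ω⟩
    exact Nat.one_le_cast.2 Fintype.card_pos
  refine (condEntropy_le_crossEntropy hp A B
    (q := fun a b => (if a = d b then 1 / 2 else 0) + (2 * N)⁻¹)
    (fun a b => by split_ifs <;> positivity) (fun b => ?_) fun ω _ => ?_).trans ?_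
  · rw [Finset.sum_add_distrib]
    simp only [Finset.sum_ite_eq', Finset.mem_univ, if_true, Finset.sum_const, Finset.card_univ,
      nsmul_eq_mul, mul_inv]
    have : N * N⁻¹ ≤ 1 := mul_inv_le_one
    rw [← hN]
    nlinarith
  · have := hne ω
    have h : 0 < (2 * N)⁻¹ := by positivity
    split_ifs <;> linarith
  · rw [add_assoc]
    gcongr
    rw [prob, Finset.sum_mul]
    nth_rewrite 2 [← hp.2]
    rw [← Finset.sum_add_distrib]
    refine Finset.sum_le_sum fun ω _ => ?_
    have h1 := hne ω
    by_cases h : A ω = d (B ω)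
    · simp only [h, if_true, ne_eq, not_true_eq_false, if_false, zero_mul, add_zero]
      refine mul_le_of_le_one_right (hp.1 ω) ?_
      rw [neg_le, Real.le_logb_iff_rpow_le one_lt_two (by positivity), Real.rpow_neg_one]
      have : 0 < (2 * N)⁻¹ := by positivity
      linarith
    · simp only [h, if_false, ne_eq, not_false_eq_true, if_true, zero_add, Real.logb_inv, neg_neg]
      rw [Real.logb_mul two_ne_zero (by positivity), Real.logb_self_eq_one one_lt_two]
      exact le_of_eq (by ring)

end Entropy

/-! ### Memoryless blocks -/

section Iid

variable {Ω α : Type*} [Fintype Ω] [Fintype α] {p : Ω → ℝ} {n : ℕ}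

/-- The product law `p^n` on blocks of length `n`. -/
noncomputable def iidLaw (p : Ω → ℝ) (n : ℕ) : (Fin n → Ω) → ℝ := fun ω => ∏ i, p (ω i)

lemma sum_pi_prod (F : Fin n → Ω → ℝ) : ∑ ω : Fin n → Ω, ∏ i, F i (ω i) = ∏ i, ∑ w, F i w := by
  classical
  rw [Finset.prod_univ_sum, Fintype.piFinset_univ]

lemma iidLaw_mem (hp : p ∈ stdSimplex ℝ Ω) (n : ℕ) : iidLaw p n ∈ stdSimplex ℝ (Fin n → Ω) :=
  ⟨fun _ => Finset.prod_nonneg fun _ _ => hp.1 _, by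
    simp only [iidLaw]
    rw [sum_pi_prod (fun _ => p)]
    simp [hp.2]⟩

lemma sum_iidLaw_mul_sum (hp : p ∈ stdSimplex ℝ Ω) (f : Ω → ℝ) :
    ∑ ω, iidLaw p n ω * ∑ i, f (ω i) = n * ∑ w, p w * f w := by
  classical
  simp only [Finset.mul_sum]
  rw [Finset.sum_comm]
  have : ∀ j : Fin n, ∑ ω : Fin n → Ω, iidLaw p n ω * f (ω j) = ∑ w, p w * f w := by
    intro j
    have h1 : ∀ ω : Fin n → Ω, iidLaw p n ω * f (ω j)
        = ∏ i, p (ω i) * (if i = j then f (ω i) else 1) := by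
      intro ω
      rw [Finset.prod_mul_distrib]
      simp [iidLaw]
    simp only [h1]
    rw [sum_pi_prod (fun i w => p w * if i = j then f w else 1),
      Finset.prod_eq_single j (fun i _ hi => by simp [hi, hp.2]) (by simp)]
    simp
  simp [this, Finset.mul_sum]

lemma prob_iidLaw_map {δ : Type*} (p : Ω → ℝ) (A : Ω → δ) (a : Fin n → δ) :
    prob (iidLaw p n) (fun ω => (fun i => A (ω i)) = a) = ∏ i, prob p (fun w => A w = a i) := by
  classical
  simp only [prob]
  rw [← sum_pi_prod (fun i w => if A w = a i then p w else 0)]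
  refine Finset.sum_congr rfl fun ω _ => ?_
  by_cases h : (fun i => A (ω i)) = a
  · have h' : ∀ i, A (ω i) = a i := fun i => congrFun h i
    simp [h', iidLaw]
  · rw [if_neg h]
    obtain ⟨i, hi⟩ := Function.ne_iff.1 h
    exact (Finset.prod_eq_zero (Finset.mem_univ i) (if_neg hi)).symm

lemma entropy_iidLaw (hp : p ∈ stdSimplex ℝ Ω) (A : Ω → α) :
    entropy (iidLaw p n) (fun ω i => A (ω i)) = n * entropy p A := by
  rw [entropy_eq p, ← sum_iidLaw_mul_sum hp, entropy_eq]
  refine Finset.sum_congr rfl fun ω _ => ?_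
  rcases ((iidLaw_mem hp n).1 ω).eq_or_lt with h0 | h0
  · simp [← h0]
  rw [prob_iidLaw_map, Real.logb_prod _ _ fun i _ => ?_, Finset.sum_neg_distrib]
  refine (prob_self_pos hp.1 A ((hp.1 _).lt_of_ne fun h => h0.ne' ?_)).ne'
  exact Finset.prod_eq_zero (Finset.mem_univ i) h.symm

end Iid

/-! ### Random binning -/

section Hash

variable {H H₁ H₂ α M M₁ M₂ : Type*} [Fintype H] [Fintype H₁] [Fintype H₂]

/-- A universal family of hash functions `hash h : α → M`: for uniformly random `h`, two distinct
points collide with probability at most `1 / m`. The number of colliding indices is written as the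
total weight of the collision event under the counting weight. -/
def IsUniversal (hash : H → α → M) (m : ℝ) : Prop :=
  ∀ a a', a ≠ a' → m * prob (fun _ : H => (1 : ℝ)) (fun h => hash h a = hash h a') ≤ Fintype.card H

lemma prob_prod_count (E₁ : H₁ → Prop) (E₂ : H₂ → Prop) :
    prob (fun _ : H₁ × H₂ => (1 : ℝ)) (fun h => E₁ h.1 ∧ E₂ h.2)
      = prob (fun _ => 1) E₁ * prob (fun _ => 1) E₂ := by
  classical
  simp only [prob, Finset.sum_mul_sum, Fintype.sum_prod_type]
  refine Finset.sum_congr rfl fun a _ => Finset.sum_congr rfl fun b _ => ?_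
  by_cases h1 : E₁ a <;> by_cases h2 : E₂ b <;> simp [h1, h2]

lemma IsUniversal.prod {hash₁ : H₁ → α → M₁} {hash₂ : H₂ → α → M₂} {m₁ m₂ : ℝ}
    (h₁ : IsUniversal hash₁ m₁) (h₂ : IsUniversal hash₂ m₂) (hm₂ : 0 ≤ m₂) :
    IsUniversal (fun (h : H₁ × H₂) a => (hash₁ h.1 a, hash₂ h.2 a)) (m₁ * m₂) := by
  intro a a' hne
  simp only [Prod.mk.injEq]
  rw [prob_prod_count (fun h => hash₁ h a = hash₁ h a') (fun h => hash₂ h a = hash₂ h a'),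
    Fintype.card_prod, Nat.cast_mul, mul_mul_mul_comm]
  exact mul_le_mul (h₁ a a' hne) (h₂ a a' hne)
    (mul_nonneg hm₂ (prob_nonneg (fun _ => zero_le_one) _)) (Nat.cast_nonneg _)

lemma IsUniversal.fst {hash : H₁ → α → M} {m : ℝ} (h : IsUniversal hash m) :
    IsUniversal (fun (k : H₁ × H₂) a => hash k.1 a) m := by
  intro a a' hne
  have := prob_prod_count (fun h => hash h a = hash h a') (fun _ : H₂ => True)
  simp only [and_true] at this
  rw [this, Fintype.card_prod, Nat.cast_mul, ← mul_assoc]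
  simpa [prob] using mul_le_mul_of_nonneg_right (h a a' hne) (Nat.cast_nonneg (Fintype.card H₂))

lemma IsUniversal.snd {hash : H₂ → α → M} {m : ℝ} (h : IsUniversal hash m) :
    IsUniversal (fun (k : H₁ × H₂) a => hash k.2 a) m := by
  intro a a' hne
  have := prob_prod_count (fun _ : H₁ => True) (fun h => hash h a = hash h a')
  simp only [true_and] at this
  rw [this, Fintype.card_prod, Nat.cast_mul, mul_left_comm]
  simpa [prob] using mul_le_mul_of_nonneg_left (h a a' hne) (Nat.cast_nonneg (Fintype.card H₁))

/-- The family of all functions is universal: the values at `a` of a function colliding at `a` and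
`a'` can be changed freely, which embeds `M × {collisions}` into the functions. -/
lemma isUniversal_all [Fintype α] [DecidableEq α] [Fintype M] :
    IsUniversal (fun (h : α → M) a => h a) (Fintype.card M) := by
  classical
  intro a a' hne
  have h1 : prob (fun _ : α → M => (1 : ℝ)) (fun h => h a = h a')
      = Fintype.card {h : α → M // h a = h a'} := by
    simp [prob, Fintype.card_subtype]
  rw [h1, ← Nat.cast_mul, ← Fintype.card_prod]
  refine Nat.cast_le.2 (Fintype.card_le_of_injective
    (fun x : M × {h : α → M // h a = h a'} => Function.update x.2.1 a x.1) ?_)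
  rintro ⟨m, h, hh⟩ ⟨m', h', hh'⟩ heq
  have hm : m = m' := by simpa using congrFun heq a
  have hoff : ∀ b, b ≠ a → h b = h' b := fun b hb => by
    simpa [hb] using congrFun heq b
  simp only [Prod.mk.injEq, Subtype.mk.injEq]
  refine ⟨hm, funext fun b => ?_⟩
  by_cases hb : b = a
  · rw [hb, hh, hh', hoff a' hne.symm]
  · exact hoff b hb

end Hash

section Binning

variable {Ω H α β M : Type*} [Fintype Ω] [Fintype H] [Fintype α] {p : Ω → ℝ}

open Classical in
/-- The bin decoder: a point of bin `k` that is jointly typical with `b`, if there is one. -/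
noncomputable def binDecoder [Nonempty α] (T : α → β → Prop) (f : α → M) (b : β) (k : M) : α :=
  if h : ∃ a, T a b ∧ f a = k then h.choose else Classical.arbitrary α

lemma ne_binDecoder [Nonempty α] {T : α → β → Prop} {f : α → M} {a : α} {b : β}
    (hT : T a b) (h : a ≠ binDecoder T f b (f a)) : ∃ a', a' ≠ a ∧ T a' b ∧ f a' = f a := by
  have hex : ∃ a', T a' b ∧ f a' = f a := ⟨a, hT, rfl⟩
  rw [binDecoder, dif_pos hex] at h
  exact ⟨_, h.symm, hex.choose_spec⟩

/-- One-shot random binning with side information: on average over a universal family, the bin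
decoder fails with probability at most that of atypicality plus (number of candidates) / `m`. -/
lemma sum_binDecoder_error_le [Nonempty α] (hp : p ∈ stdSimplex ℝ Ω) (A : Ω → α) (B : Ω → β)
    (T : α → β → Prop) {N m : ℝ} (hT : ∀ b, prob (fun _ : α => (1 : ℝ)) (fun a => T a b) ≤ N)
    {hash : H → α → M} (hm : 0 < m) (hash_univ : IsUniversal hash m) :
    ∑ h, prob p (fun ω => A ω ≠ binDecoder T (hash h) (B ω) (hash h (A ω)))
      ≤ Fintype.card H * (prob p (fun ω => ¬ T (A ω) (B ω)) + N / m) := by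
  classical
  set C : ℝ := (Fintype.card H : ℝ) with hC
  have hpt : ∀ h ω, (if A ω ≠ binDecoder T (hash h) (B ω) (hash h (A ω)) then p ω else 0)
      ≤ (if ¬ T (A ω) (B ω) then p ω else 0) + p ω * ∑ a, if T a (B ω) then
          (if a ≠ A ω ∧ hash h a = hash h (A ω) then 1 else 0) else 0 := by
    intro h ω
    have hnn : ∀ a, (0 : ℝ) ≤ if T a (B ω) then
          (if a ≠ A ω ∧ hash h a = hash h (A ω) then 1 else 0) else 0 := fun a => by
      split_ifs <;> norm_num
    have h2 : 0 ≤ p ω * ∑ a, if T a (B ω) then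
          (if a ≠ A ω ∧ hash h a = hash h (A ω) then (1 : ℝ) else 0) else 0 :=
      mul_nonneg (hp.1 ω) (Finset.sum_nonneg fun a _ => hnn a)
    by_cases hty : T (A ω) (B ω)
    · by_cases herr : A ω ≠ binDecoder T (hash h) (B ω) (hash h (A ω))
      · obtain ⟨a', hne, hT', hh⟩ := ne_binDecoder hty herr
        have h3 := Finset.single_le_sum (fun a _ => hnn a) (Finset.mem_univ a')
        rw [if_pos hT', if_pos ⟨hne, hh⟩] at h3
        rw [if_pos herr, if_neg (not_not.2 hty), zero_add]
        exact le_mul_of_one_le_right (hp.1 ω) h3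
      · rw [if_neg herr, if_neg (not_not.2 hty), zero_add]
        exact h2
    · rw [if_pos hty]
      split_ifs
      · linarith
      · linarith [hp.1 ω]
  have hcoll : ∀ ω a, ∑ h, (if T a (B ω) then
      (if a ≠ A ω ∧ hash h a = hash h (A ω) then (1 : ℝ) else 0) else 0)
      ≤ (if T a (B ω) then 1 else 0) * (C / m) := by
    intro ω a
    have hCm : 0 ≤ C / m := by positivity
    by_cases hTa : T a (B ω)
    · simp only [hTa, if_true, one_mul]
      by_cases hne : a = A ω
      · simpa [hne] using hCm
      · rw [le_div_iff₀ hm, mul_comm]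
        have := hash_univ a (A ω) hne
        simp only [prob] at this
        simpa [hne] using this
    · simp [hTa]
  calc _ ≤ ∑ h : H, ∑ ω, ((if ¬ T (A ω) (B ω) then p ω else 0) + p ω * ∑ a, if T a (B ω) then
          (if a ≠ A ω ∧ hash h a = hash h (A ω) then 1 else 0) else 0) :=
        Finset.sum_le_sum fun h _ =>
          (prob_eq_sum p _).trans_le (Finset.sum_le_sum fun ω _ => hpt h ω)
    _ = C * prob p (fun ω => ¬ T (A ω) (B ω)) + ∑ ω, p ω * ∑ a, ∑ h, if T a (B ω) then
          (if a ≠ A ω ∧ hash h a = hash h (A ω) then 1 else 0) else 0 := by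
        simp only [Finset.sum_add_distrib]
        congr 1
        · rw [prob_eq_sum, Finset.sum_const, Finset.card_univ, nsmul_eq_mul]
        · rw [Finset.sum_comm]
          refine Finset.sum_congr rfl fun ω _ => ?_
          rw [← Finset.mul_sum, Finset.sum_comm]
    _ ≤ C * prob p (fun ω => ¬ T (A ω) (B ω)) + ∑ ω, p ω * (N * (C / m)) := by
        refine add_le_add le_rfl (Finset.sum_le_sum fun ω _ =>
          mul_le_mul_of_nonneg_left ?_ (hp.1 ω))
        refine (Finset.sum_le_sum fun a _ => hcoll ω a).trans ?_
        rw [← Finset.sum_mul]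
        exact mul_le_mul_of_nonneg_right (hT (B ω)) (by positivity)
    _ = C * (prob p (fun ω => ¬ T (A ω) (B ω)) + N / m) := by
        rw [← Finset.sum_mul, hp.2]; ring

/-- Chernoff's bound: the empirical sum of a memoryless block exceeds `n γ`, with `γ` larger than
the mean, with exponentially small probability. -/
lemma exists_chernoff (hp : p ∈ stdSimplex ℝ Ω) (f : Ω → ℝ) {γ : ℝ} (hγ : ∑ w, p w * f w < γ) :
    ∃ ρ : ℝ, 0 ≤ ρ ∧ ρ < 1 ∧
      ∀ n : ℕ, prob (iidLaw p n) (fun ω => n * γ < ∑ i, f (ω i)) ≤ ρ ^ n := by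
  -- The moment generating function of `f - γ` is `1` at `0` and has a negative derivative there.
  set F : ℝ → ℝ := fun s => ∑ w, p w * Real.exp (s * (f w - γ)) with hF
  have hder : HasDerivAt F (∑ w, p w * (f w - γ)) 0 := by
    refine HasDerivAt.fun_sum fun w _ => ?_
    have h1 : HasDerivAt (fun s : ℝ => s * (f w - γ)) (f w - γ) 0 := by
      simpa using (hasDerivAt_id (0 : ℝ)).mul_const (f w - γ)
    simpa using h1.exp.const_mul (p w)
  have hneg : ∑ w, p w * (f w - γ) < 0 := by
    simp only [mul_sub, Finset.sum_sub_distrib, ← Finset.sum_mul, hp.2]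
    linarith
  have hF0 : F 0 = 1 := by simp [hF, hp.2]
  obtain ⟨s, hs, hFs⟩ : ∃ s : ℝ, 0 < s ∧ F s < 1 := by
    have h1 := (hasDerivAt_iff_tendsto_slope.1 hder).eventually (gt_mem_nhds hneg)
    have h2 : ∀ᶠ s in 𝓝[>] (0 : ℝ), slope F 0 s < 0 :=
      h1.filter_mono (nhdsWithin_mono _ fun s hs => ne_of_gt hs)
    obtain ⟨s, hs1, hs2⟩ := (h2.and self_mem_nhdsWithin).exists
    refine ⟨s, hs2, ?_⟩
    rw [slope_def_field, sub_zero, hF0, div_lt_iff₀ hs2] at hs1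
    linarith
  refine ⟨F s, Finset.sum_nonneg fun w _ => mul_nonneg (hp.1 w) (Real.exp_pos _).le, hFs,
    fun n => ?_⟩
  have h3 : F s ^ n = ∑ ω : Fin n → Ω, ∏ i, (p (ω i) * Real.exp (s * (f (ω i) - γ))) := by
    rw [sum_pi_prod (fun _ w => p w * Real.exp (s * (f w - γ)))]
    simp [hF]
  rw [h3, prob]
  refine Finset.sum_le_sum fun ω _ => ?_
  rw [Finset.prod_mul_distrib, ← Real.exp_sum, ← Finset.mul_sum, Finset.sum_sub_distrib]
  have h4 := (iidLaw_mem hp n).1 ω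
  split_ifs with h
  · refine le_mul_of_one_le_right h4 (Real.one_le_exp (mul_nonneg hs.le ?_))
    simp only [Finset.sum_const, Finset.card_univ, Fintype.card_fin, nsmul_eq_mul]
    linarith
  · exact mul_nonneg h4 (Real.exp_pos _).le

end Binning

universe u

/-- Source coding with side information by random binning (Slepian–Wolf): binning `A^n` at a rate
`r > H(A | B)` lets a decoder recover `A^n` from `B^n` and the bin, with average error tending to
zero at a speed independent of the universal family. The factor `8` leaves room for bins that are
triples of integer parts. -/
lemma exists_slepianWolf {Ω β : Type*} {α : Type u} [Fintype Ω] [Fintype α] [Fintype β]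
    [Nonempty α] {p : Ω → ℝ} (hp : p ∈ stdSimplex ℝ Ω) (A : Ω → α) (B : Ω → β) {r : ℝ}
    (hr : entropy p (fun ω => (A ω, B ω)) - entropy p B < r) :
    ∃ e : ℕ → ℝ, Tendsto e atTop (𝓝 0) ∧
      ∀ (n : ℕ) (H : Type u) [Fintype H] (M : Type) (hash : H → (Fin n → α) → M) (m : ℝ),
        IsUniversal hash m → (2 : ℝ) ^ (n * r) / 8 ≤ m →
        ∃ d : H → (Fin n → β) → M → (Fin n → α),
          ∑ h, prob (iidLaw p n) (fun ω => (fun i => A (ω i)) ≠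
            d h (fun i => B (ω i)) (hash h (fun i => A (ω i)))) ≤ Fintype.card H * e n := by
  classical
  obtain ⟨γ, hγ1, hγ2⟩ := exists_between hr
  -- The conditional law of `A` given `B`.
  set c : α → β → ℝ := fun a b =>
    prob p (fun ω => (A ω, B ω) = (a, b)) / prob p (fun ω => B ω = b) with hc
  have hc0 : ∀ a b, 0 ≤ c a b := fun a b =>
    div_nonneg (prob_nonneg hp.1 _) (prob_nonneg hp.1 _)
  have hc1 : ∀ b, ∑ a, c a b ≤ 1 := fun b => by
    simp only [hc]
    rw [← Finset.sum_div, sum_prob_pair]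
    exact div_self_le_one _
  have hcpos : ∀ ω, 0 < p ω → 0 < c (A ω) (B ω) := fun ω h =>
    div_pos (prob_self_pos hp.1 (fun ω => (A ω, B ω)) h) (prob_self_pos hp.1 B h)
  have hmean : ∑ ω, p ω * -Real.logb 2 (c (A ω) (B ω)) < γ := by
    refine lt_of_eq_of_lt ?_ hγ1
    rw [entropy_eq p B, entropy_eq p, ← Finset.sum_sub_distrib]
    refine Finset.sum_congr rfl fun ω _ => ?_
    rcases (hp.1 ω).eq_or_lt with h0 | h0
    · simp [← h0]
    rw [Real.logb_div (prob_self_pos hp.1 (fun ω => (A ω, B ω)) h0).ne'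
      (prob_self_pos hp.1 B h0).ne']
    ring
  obtain ⟨ρ, hρ0, hρ1, hρ⟩ := exists_chernoff hp _ hmean
  refine ⟨fun n => ρ ^ n + 8 * ((2 : ℝ) ^ (γ - r)) ^ n, ?_, ?_⟩
  · have h1 := tendsto_pow_atTop_nhds_zero_of_lt_one hρ0 hρ1
    have h2 := tendsto_pow_atTop_nhds_zero_of_lt_one (r := (2 : ℝ) ^ (γ - r)) (by positivity)
      (Real.rpow_lt_one_of_one_lt_of_neg one_lt_two (by linarith))
    simpa using h1.add (h2.const_mul 8)
  intro n H _ M hash m hash_univ hm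
  have hm0 : 0 < m := lt_of_lt_of_le (by positivity) hm
  set T : (Fin n → α) → (Fin n → β) → Prop := fun a b =>
    (2 : ℝ) ^ (-(n * γ)) ≤ ∏ i, c (a i) (b i) with hTdef
  have hcard : ∀ b, prob (fun _ : Fin n → α => (1 : ℝ)) (fun a => T a b)
      ≤ (2 : ℝ) ^ (n * γ) := by
    intro b
    have h1 : ∑ a : Fin n → α, ∏ i, c (a i) (b i) ≤ 1 := by
      rw [sum_pi_prod (fun i a => c a (b i))]
      exact Finset.prod_le_one (fun i _ => Finset.sum_nonneg fun a _ => hc0 _ _)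
        fun i _ => hc1 _
    have h2 : prob (fun _ : Fin n → α => (1 : ℝ)) (fun a => T a b)
        ≤ ∑ a : Fin n → α, (2 : ℝ) ^ (n * γ) * ∏ i, c (a i) (b i) := by
      refine Finset.sum_le_sum fun a _ => ?_
      split_ifs with h
      · calc (1 : ℝ) = (2 : ℝ) ^ (n * γ) * (2 : ℝ) ^ (-(n * γ)) := by
              rw [← Real.rpow_add two_pos]; simp
          _ ≤ _ := by gcongr
      · exact mul_nonneg (by positivity) (Finset.prod_nonneg fun i _ => hc0 _ _)
    rw [← Finset.mul_sum] at h2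
    exact h2.trans (mul_le_of_le_one_right (by positivity) h1)
  refine ⟨fun h => binDecoder T (hash h), (sum_binDecoder_error_le (iidLaw_mem hp n)
    (fun ω i => A (ω i)) (fun ω i => B (ω i)) T hcard hm0 hash_univ).trans ?_⟩
  refine mul_le_mul_of_nonneg_left (add_le_add ?_ ?_) (Nat.cast_nonneg _)
  · refine (prob_mono (iidLaw_mem hp n).1 fun ω h0 hT => ?_).trans (hρ n)
    have hpos : ∀ i, 0 < c (A (ω i)) (B (ω i)) := fun i => hcpos _ <|
      (hp.1 _).lt_of_ne fun h => h0.ne' (Finset.prod_eq_zero (Finset.mem_univ i) h.symm)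
    simp only [hTdef, not_le] at hT
    have := Real.logb_lt_logb one_lt_two (Finset.prod_pos fun i _ => hpos i) hT
    rw [Real.logb_rpow two_pos (by norm_num), Real.logb_prod _ _ fun i _ => (hpos i).ne'] at this
    rw [Finset.sum_neg_distrib]
    linarith
  · rw [div_le_iff₀ hm0]
    calc (2 : ℝ) ^ (n * γ) = 8 * ((2 : ℝ) ^ (γ - r)) ^ n * ((2 : ℝ) ^ (n * r) / 8) := by
          rw [← Real.rpow_mul_natCast two_pos.le]
          have : (2 : ℝ) ^ (n * γ) = (2 : ℝ) ^ ((γ - r) * n) * (2 : ℝ) ^ (n * r) := by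
            rw [← Real.rpow_add two_pos]; congr 1; ring
          rw [this]; ring
      _ ≤ _ := by gcongr

/-! ### Entropies of the degraded source -/

section Source

variable {S X Y Z : Type*} [Fintype X] [Fintype Y] [Fintype Z]
  (P : DegradedSource S X Y Z) (sab se : S)

lemma law_mem : P.law sab se ∈ stdSimplex ℝ (X × Y × Z) := by
  refine ⟨fun w => mul_nonneg ((P.main_mem _).1 _) ((P.eve_mem _ _ _).1 _), ?_⟩
  simp only [DegradedSource.law, Fintype.sum_prod_type, ← Finset.mul_sum, (P.eve_mem _ _ _).2,
    mul_one]
  rw [← (P.main_mem sab).2, Fintype.sum_prod_type]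

lemma blockLaw_mem (n : ℕ) : P.blockLaw sab se n ∈ stdSimplex ℝ (Fin n → X × Y × Z) :=
  iidLaw_mem (law_mem P sab se) n

lemma prob_main (E : X × Y → Prop) :
    prob (P.main sab) E = prob (P.law sab se) (fun w => E (w.1, w.2.1)) := by
  classical
  simp only [prob_eq_sum, DegradedSource.law, Fintype.sum_prod_type]
  refine Finset.sum_congr rfl fun x _ => Finset.sum_congr rfl fun y _ => ?_
  split_ifs
  · rw [← Finset.mul_sum, (P.eve_mem _ _ _).2, mul_one]
  · simp

lemma entropy_main {α : Type*} [Fintype α] (A : X × Y → α) :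
    entropy (P.main sab) A = entropy (P.law sab se) (fun w => A (w.1, w.2.1)) := by
  simp only [entropy, prob_main P sab se]

/-- The Markov chain `X - Y - Z`, in terms of entropies. -/
lemma entropy_law_markov :
    entropy (P.law sab se) (fun w => w) + entropy (P.law sab se) (fun w => w.2.1)
      = entropy (P.law sab se) (fun w => (w.1, w.2.1))
        + entropy (P.law sab se) (fun w => (w.2.1, w.2.2)) := by
  classical
  have hp := law_mem P sab se
  simp only [entropy_eq, ← Finset.sum_add_distrib]
  refine Finset.sum_congr rfl fun w _ => ?_
  rcases (hp.1 w).eq_or_lt with h0 | h0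
  · simp [← h0]
  obtain ⟨x, y, z⟩ := w
  have hm : P.main sab (x, y) ≠ 0 := fun h => h0.ne' (by simp [DegradedSource.law, h])
  have he : P.eve sab se y z ≠ 0 := fun h => h0.ne' (by simp [DegradedSource.law, h])
  have h1 : prob (P.law sab se) (fun w => w = (x, y, z))
      = P.main sab (x, y) * P.eve sab se y z := by
    simp [prob_eq_sum, DegradedSource.law]
  have h2 : prob (P.law sab se) (fun w => (w.1, w.2.1) = (x, y)) = P.main sab (x, y) := by
    rw [← prob_main P sab se (fun v => v = (x, y))]
    simp [prob_eq_sum]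
  have h3 : prob (P.law sab se) (fun w => (w.2.1, w.2.2) = (y, z))
      = prob (P.law sab se) (fun w => w.2.1 = y) * P.eve sab se y z := by
    rw [← prob_main P sab se (fun v => v.2 = y)]
    simp [prob_eq_sum, DegradedSource.law, Fintype.sum_prod_type, Finset.sum_mul]
  have hy : prob (P.law sab se) (fun w => w.2.1 = y) ≠ 0 :=
    (prob_self_pos hp.1 (fun w => w.2.1) h0).ne'
  dsimp only
  rw [h1, h2, h3, Real.logb_mul hm he, Real.logb_mul hy he]
  ring

/-- `C_s = H(X | Z) - H(X | Y)`. -/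
lemma Cs_eq : P.Cs sab se
    = entropy (P.law sab se) (fun w => (w.1, w.2.2)) - entropy (P.law sab se) (fun w => w.2.2)
      - (entropy (P.law sab se) (fun w => (w.1, w.2.1))
        - entropy (P.law sab se) (fun w => w.2.1)) := by
  simp only [DegradedSource.Cs, mutualInfo, entropy_main P sab se]
  ring

lemma Cs_le_entropy : P.Cs sab se ≤ entropy (P.law sab se) (fun w => w.1) := by
  have hp := law_mem P sab se
  rw [Cs_eq]
  have h1 := entropy_subadditive hp (fun w => w.1) (fun w => w.2.2)
  have h2 : entropy (P.law sab se) (fun w => w.2.1)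
      ≤ entropy (P.law sab se) (fun w => (w.1, w.2.1)) :=
    entropy_le_of_determined hp fun _ _ h => (Prod.mk.inj h).2
  linarith

lemma entropy_blockLaw {α : Type*} [Fintype α] (n : ℕ) (A : X × Y × Z → α) :
    entropy (P.blockLaw sab se n) (fun ω i => A (ω i)) = n * entropy (P.law sab se) A :=
  entropy_iidLaw (law_mem P sab se) A

lemma entropy_blockLaw_XZ (n : ℕ) :
    entropy (P.blockLaw sab se n) (fun ω => (obsX ω, obsZ ω))
      = n * entropy (P.law sab se) (fun w => (w.1, w.2.2)) := by
  rw [← entropy_blockLaw]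
  exact entropy_eq_of_determined (blockLaw_mem P sab se n) fun ω ω' => by
    simp [funext_iff, obsX, obsZ, forall_and]

lemma entropy_blockLaw_YZ (n : ℕ) :
    entropy (P.blockLaw sab se n) (fun ω => (obsY ω, obsZ ω))
      = n * entropy (P.law sab se) (fun w => (w.2.1, w.2.2)) := by
  rw [← entropy_blockLaw]
  exact entropy_eq_of_determined (blockLaw_mem P sab se n) fun ω ω' => by
    simp only [funext_iff, obsY, obsZ, Prod.mk.injEq, forall_and]

lemma logb_card_block (n : ℕ) :
    Real.logb 2 (Fintype.card (Fin n → X)) = n * Real.logb 2 (Fintype.card X) := by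
  simp [Real.logb_pow]

/-! ### The lower bound on the leakage -/

/-- Whatever the key, the part of its entropy exceeding `n C_s` leaks, up to the Fano term: given
`Z^n` and the message, the uncertainty about `X^n` is at most `n C_s` plus that of Bob. -/
lemma key_entropy_sub_le_mutualInfo {κ φ : Type*} [Fintype κ] [Fintype φ] {n : ℕ}
    (k : (Fin n → X) → κ) (g : (Fin n → X) → φ) (d : (Fin n → Y) → φ → (Fin n → X)) :
    entropy (P.blockLaw sab se n) (fun ω => k (obsX ω)) - n * P.Cs sab se
        - (1 + prob (P.blockLaw sab se n) (fun ω => obsX ω ≠ d (obsY ω) (g (obsX ω)))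
          * (n * Real.logb 2 (Fintype.card X)))
      ≤ mutualInfo (P.blockLaw sab se n) (fun ω => k (obsX ω))
        (fun ω => (obsZ ω, g (obsX ω))) := by
  have hq := blockLaw_mem P sab se n
  set q := P.blockLaw sab se n
  have h1 : entropy q (fun ω => (k (obsX ω), obsZ ω, g (obsX ω)))
      ≤ entropy q (fun ω => (obsX ω, obsZ ω)) :=
    entropy_le_of_determined hq fun ω ω' h => by
      obtain ⟨hx, hz⟩ := Prod.mk.inj h
      simp only [hx, hz]
  have h2 := entropy_submodular hq obsY (fun ω => g (obsX ω)) obsZ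
  have h3 : entropy q (fun ω => (g (obsX ω), obsZ ω)) = entropy q (fun ω => (obsZ ω, g (obsX ω))) :=
    entropy_eq_of_determined hq fun ω ω' => by simp [and_comm]
  have h4 := fano hq obsX (fun ω => (obsY ω, g (obsX ω), obsZ ω)) (fun b => d b.1 b.2.1)
  rw [logb_card_block] at h4
  have h5 : entropy q (fun ω i => ω i)
      ≤ entropy q (fun ω => (obsX ω, obsY ω, g (obsX ω), obsZ ω)) :=
    entropy_le_of_determined hq fun ω ω' h => by
      simp only [Prod.mk.injEq] at h
      obtain ⟨hx, hy, -, hz⟩ := h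
      exact funext fun i => Prod.ext (congrFun hx i) (Prod.ext (congrFun hy i) (congrFun hz i))
  have h6 : entropy q obsZ = n * entropy (P.law sab se) (fun w => w.2.2) :=
    entropy_blockLaw P sab se n (fun w => w.2.2)
  rw [entropy_blockLaw P sab se n (fun w => w)] at h5
  rw [entropy_blockLaw_XZ] at h1
  rw [entropy_blockLaw_YZ, h6] at h2
  have h7 := congrArg (fun t => (n : ℝ) * t) (entropy_law_markov P sab se)
  simp only [mul_add] at h7
  rw [Cs_eq, mutualInfo]
  simp only [mul_sub]
  linarith

end Source

lemma tendsto_fano_term {e : ℕ → ℝ} (he : Tendsto e atTop (𝓝 0)) (L : ℝ) :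
    Tendsto (fun n : ℕ => 1 / (n : ℝ) + e n * L) atTop (𝓝 0) := by
  simpa using tendsto_one_div_atTop_nhds_zero_nat.add (he.mul_const L)

section Converse

variable {S X Y Z : Type*} [Fintype X] [Fintype Y] [Fintype Z]

lemma eventually_le_leakage (P : DegradedSource S X Y Z) (sab se : S) {R Rφ ε : ℝ} (hε : 0 < ε)
    (c : ∀ n, KeySystem S X Y R Rφ n) (hrate : ∀ᶠ n in atTop, R - ε < keyRate P sab se (c n))
    (hrec : RecoversSource P sab se c) :
    ∀ᶠ n in atTop, (R - P.Cs sab se) - 2 * ε ≤ leakage P sab se (c n) := by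
  obtain ⟨d, hd⟩ := hrec
  filter_upwards [hrate, eventually_gt_atTop 0,
    (tendsto_fano_term hd (Real.logb 2 (Fintype.card X))).eventually (gt_mem_nhds hε)]
    with n h1 hn h2
  have hn' : (0 : ℝ) < n := Nat.cast_pos.2 hn
  have h3 := key_entropy_sub_le_mutualInfo P sab se (fun x => (c n).f₁ x sab)
    (fun x => (c n).g x sab) (fun y φ => d n y sab φ)
  rw [keyRate, lt_div_iff₀ hn'] at h1
  rw [leakage, le_div_iff₀ hn']
  have h4 := mul_lt_mul_of_pos_right h2 hn'
  rw [add_mul, one_div_mul_cancel hn'.ne'] at h4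
  linarith

end Converse

/-! ### Schemes obtained by random binning -/

lemma half_le_card_index (n : ℕ) {r : ℝ} (hr : 0 ≤ r) :
    (2 : ℝ) ^ (n * r) / 2 ≤ Fintype.card (Index n r) := by
  have h1 : (1 : ℝ) ≤ 2 ^ (n * r) := Real.one_le_rpow one_le_two (by positivity)
  have h2 := Nat.lt_floor_add_one ((2 : ℝ) ^ (n * r))
  have h3 : (1 : ℝ) ≤ ⌊(2 : ℝ) ^ (n * r)⌋₊ := Nat.one_le_cast.2 (Nat.le_floor (by simpa using h1))
  rw [Fintype.card_fin]
  linarith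

lemma logb_card_index_le (n : ℕ) {r : ℝ} (hr : 0 ≤ r) :
    Real.logb 2 (Fintype.card (Index n r)) ≤ n * r := by
  have h0 : (0 : ℝ) < Fintype.card (Index n r) :=
    lt_of_lt_of_le (by positivity) (half_le_card_index n hr)
  rw [Real.logb_le_iff_le_rpow one_lt_two h0, Fintype.card_fin]
  exact Nat.floor_le (by positivity)

lemma nonempty_index (n : ℕ) {r : ℝ} (hr : 0 ≤ r) : Nonempty (Index n r) :=
  Fintype.card_pos_iff.1 (Nat.cast_pos.1 (lt_of_lt_of_le (by positivity) (half_le_card_index n hr)))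

lemma logb_two_natCast_nonneg (k : ℕ) : 0 ≤ Real.logb 2 k :=
  div_nonneg (Real.log_natCast_nonneg k) (Real.log_nonneg one_le_two)

/-- If three nonnegative functions have averages at most `e₁`, `e₂`, `e₃`, then at some point all of
them are at most `e₁ + e₂ + e₃`. -/
lemma exists_le_of_three_averages {H : Type*} [Fintype H] [Nonempty H] {f₁ f₂ f₃ : H → ℝ}
    {e₁ e₂ e₃ : ℝ} (h₁ : ∀ h, 0 ≤ f₁ h) (h₂ : ∀ h, 0 ≤ f₂ h) (h₃ : ∀ h, 0 ≤ f₃ h)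
    (H₁ : ∑ h, f₁ h ≤ Fintype.card H * e₁) (H₂ : ∑ h, f₂ h ≤ Fintype.card H * e₂)
    (H₃ : ∑ h, f₃ h ≤ Fintype.card H * e₃) :
    ∃ h, f₁ h ≤ e₁ + e₂ + e₃ ∧ f₂ h ≤ e₁ + e₂ + e₃ ∧ f₃ h ≤ e₁ + e₂ + e₃ := by
  obtain ⟨h, -, hh⟩ := Finset.exists_le_of_sum_le Finset.univ_nonempty
    (f := fun h => f₁ h + f₂ h + f₃ h) (g := fun _ => e₁ + e₂ + e₃) (by
      simp only [Finset.sum_add_distrib, Finset.sum_const, Finset.card_univ, nsmul_eq_mul]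
      linarith)
  have := h₁ h
  have := h₂ h
  have := h₃ h
  exact ⟨h, by linarith, by linarith, by linarith⟩

section Achievability

variable {S Y Z : Type*} {X : Type u} [Fintype X] [Fintype Y] [Fintype Z]

/-- Simultaneous random binning. The message `g`, the key `k` and two auxiliary indices `j₁`, `j₂`
can be chosen so that `X^n` is recovered, with vanishing error, by Bob from `g`, by Eve from `g`,
`k` and `j₁`, and from `k` and `j₂` alone, as soon as the rates suffice for each of these tasks. -/
lemma exists_binning (P : DegradedSource S X Y Z) (sab se : S) {R Rφ R₁ R₂ : ℝ}
    (hR : 0 ≤ R) (hRφ : 0 ≤ Rφ) (hR₁ : 0 ≤ R₁) (hR₂ : 0 ≤ R₂)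
    (hY : entropy (P.law sab se) (fun w => (w.1, w.2.1))
      - entropy (P.law sab se) (fun w => w.2.1) < Rφ)
    (hZ : entropy (P.law sab se) (fun w => (w.1, w.2.2))
      - entropy (P.law sab se) (fun w => w.2.2) < Rφ + R + R₁)
    (hX : entropy (P.law sab se) (fun w => w.1) < R + R₂) :
    ∃ e : ℕ → ℝ, Tendsto e atTop (𝓝 0) ∧ ∀ n : ℕ,
      ∃ (g : (Fin n → X) → Index n Rφ) (k : (Fin n → X) → Index n R)
        (j₁ : (Fin n → X) → Index n R₁) (j₂ : (Fin n → X) → Index n R₂)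
        (dY : (Fin n → Y) → Index n Rφ → (Fin n → X))
        (dZ : (Fin n → Z) → Index n Rφ × Index n R × Index n R₁ → (Fin n → X))
        (dX : (Fin n → Unit) → Index n R × Index n R₂ → (Fin n → X)),
        prob (P.blockLaw sab se n) (fun ω => obsX ω ≠ dY (obsY ω) (g (obsX ω))) ≤ e n ∧
        prob (P.blockLaw sab se n) (fun ω => obsX ω ≠
          dZ (obsZ ω) (g (obsX ω), k (obsX ω), j₁ (obsX ω))) ≤ e n ∧
        prob (P.blockLaw sab se n) (fun ω => obsX ω ≠
          dX (fun _ => ()) (k (obsX ω), j₂ (obsX ω))) ≤ e n := by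
  classical
  have hp := law_mem P sab se
  have : Nonempty X := by
    by_contra h
    rw [not_nonempty_iff] at h
    simpa using hp.2
  have hX' : entropy (P.law sab se) (fun w => (w.1, ())) - entropy (P.law sab se) (fun _ => ())
      < R + R₂ := by
    have h1 : entropy (P.law sab se) (fun _ => ()) = 0 := by simp [entropy, prob, hp.2]
    have h2 : entropy (P.law sab se) (fun w => (w.1, ())) ≤ entropy (P.law sab se) (fun w => w.1) :=
      entropy_le_of_determined hp fun _ _ h => by simpa using h
    linarith
  obtain ⟨e₁, he₁, H₁⟩ := exists_slepianWolf hp (fun w => w.1) (fun w => w.2.1) hY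
  obtain ⟨e₂, he₂, H₂⟩ := exists_slepianWolf hp (fun w => w.1) (fun w => w.2.2) hZ
  obtain ⟨e₃, he₃, H₃⟩ := exists_slepianWolf hp (fun w => w.1) (fun _ => ()) hX'
  refine ⟨fun n => e₁ n + e₂ n + e₃ n, by simpa using (he₁.add he₂).add he₃, fun n => ?_⟩
  have cφ := half_le_card_index n hRφ
  have cR := half_le_card_index n hR
  have c₁ := half_le_card_index n hR₁
  have c₂ := half_le_card_index n hR₂
  have uφ := isUniversal_all (α := Fin n → X) (M := Index n Rφ)
  have uR := isUniversal_all (α := Fin n → X) (M := Index n R)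
  have u₁ := isUniversal_all (α := Fin n → X) (M := Index n R₁)
  have u₂ := isUniversal_all (α := Fin n → X) (M := Index n R₂)
  obtain ⟨d₁, D₁⟩ := H₁ n _ _ _ _ (uφ.fst (H₂ := ((Fin n → X) → Index n R) ×
      ((Fin n → X) → Index n R₁) × ((Fin n → X) → Index n R₂)))
    (le_trans (by linarith [Real.rpow_pos_of_pos two_pos (n * Rφ)]) cφ)
  obtain ⟨d₂, D₂⟩ := H₂ n _ _ _ _ (uφ.prod (uR.prod (u₁.fst (H₂ := (Fin n → X) → Index n R₂))
      (Nat.cast_nonneg _)) (by positivity)) (by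
    calc (2 : ℝ) ^ (n * (Rφ + R + R₁)) / 8
        = 2 ^ (n * Rφ) / 2 * (2 ^ (n * R) / 2 * (2 ^ (n * R₁) / 2)) := by
          rw [mul_add, mul_add, Real.rpow_add two_pos, Real.rpow_add two_pos]; ring
      _ ≤ _ := by gcongr)
  obtain ⟨d₃, D₃⟩ := H₃ n _ _ _ _ ((uR.prod (u₂.snd (H₁ := (Fin n → X) → Index n R₁))
      (Nat.cast_nonneg _)).snd (H₁ := (Fin n → X) → Index n Rφ)) (by
    calc (2 : ℝ) ^ (n * (R + R₂)) / 8
        ≤ 2 ^ (n * R) / 2 * (2 ^ (n * R₂) / 2) := by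
          rw [mul_add, Real.rpow_add two_pos]
          have : (0 : ℝ) < 2 ^ (n * R) * 2 ^ (n * R₂) := by positivity
          linarith
      _ ≤ _ := by gcongr)
  have := nonempty_index n hR
  have := nonempty_index n hRφ
  have := nonempty_index n hR₁
  have := nonempty_index n hR₂
  -- Some choice of the functions is good for all three decoders at once.
  have nn := fun E => prob_nonneg (blockLaw_mem P sab se n).1 E
  obtain ⟨h, E₁, E₂, E₃⟩ := exists_le_of_three_averages (fun h => nn _) (fun h => nn _)
    (fun h => nn _) D₁ D₂ D₃
  exact ⟨h.1, h.2.1, h.2.2.1, h.2.2.2, d₁ h, d₂ h, d₃ h, E₁, E₂, E₃⟩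

/-- If `X^n` is recovered from the key and an index of rate `R₂`, then the key has entropy rate
at least `H(X) - R₂`, up to the Fano term. -/
lemma le_key_entropy (P : DegradedSource S X Y Z) (sab se : S) {κ : Type*} [Fintype κ] {R₂ : ℝ}
    (hR₂ : 0 ≤ R₂) {n : ℕ} (k : (Fin n → X) → κ) (j : (Fin n → X) → Index n R₂)
    (d : (Fin n → Unit) → κ × Index n R₂ → (Fin n → X)) {e : ℝ}
    (he : prob (P.blockLaw sab se n) (fun ω => obsX ω ≠
      d (fun _ => ()) (k (obsX ω), j (obsX ω))) ≤ e) :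
    n * entropy (P.law sab se) (fun w => w.1) - n * R₂
        - (1 + e * (n * Real.logb 2 (Fintype.card X)))
      ≤ entropy (P.blockLaw sab se n) (fun ω => k (obsX ω)) := by
  have hq := blockLaw_mem P sab se n
  rw [← entropy_blockLaw]
  set q := P.blockLaw sab se n
  have h1 := fano hq obsX (fun ω => (j (obsX ω), k (obsX ω))) (fun b => d (fun _ => ()) (b.2, b.1))
  rw [logb_card_block] at h1
  have h2 : entropy q obsX ≤ entropy q (fun ω => (obsX ω, j (obsX ω), k (obsX ω))) :=
    entropy_le_of_determined hq fun _ _ h => (Prod.mk.inj h).1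
  have h3 := entropy_pair_le_add_logb_card hq (fun ω => j (obsX ω)) (fun ω => k (obsX ω))
  have h4 := logb_card_index_le n hR₂
  have h5 := mul_le_mul_of_nonneg_right he (mul_nonneg (Nat.cast_nonneg n)
    (logb_two_natCast_nonneg (Fintype.card X)))
  change entropy q obsX - _ - _ ≤ _
  linarith

/-- If `X^n` is recovered from Eve's observations, the key and an index of rate `R₁`, then the
leakage is at most `R + Rφ + R₁ - H(X | Z)`, up to the Fano term. -/
lemma mutualInfo_le (P : DegradedSource S X Y Z) (sab se : S) {R Rφ R₁ : ℝ}
    (hR : 0 ≤ R) (hRφ : 0 ≤ Rφ) (hR₁ : 0 ≤ R₁) {n : ℕ}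
    (k : (Fin n → X) → Index n R) (g : (Fin n → X) → Index n Rφ) (j : (Fin n → X) → Index n R₁)
    (d : (Fin n → Z) → Index n Rφ × Index n R × Index n R₁ → (Fin n → X)) {e : ℝ}
    (he : prob (P.blockLaw sab se n) (fun ω => obsX ω ≠
      d (obsZ ω) (g (obsX ω), k (obsX ω), j (obsX ω))) ≤ e) :
    mutualInfo (P.blockLaw sab se n) (fun ω => k (obsX ω)) (fun ω => (obsZ ω, g (obsX ω)))
      ≤ n * (R + Rφ + R₁ - (entropy (P.law sab se) (fun w => (w.1, w.2.2))
          - entropy (P.law sab se) (fun w => w.2.2)))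
        + (1 + e * (n * Real.logb 2 (Fintype.card X))) := by
  have hq := blockLaw_mem P sab se n
  have h0 := entropy_blockLaw P sab se n (fun w => w.2.2)
  have h0' := entropy_blockLaw_XZ P sab se n
  set q := P.blockLaw sab se n
  have h1 := fano hq obsX (fun ω => (j (obsX ω), k (obsX ω), obsZ ω, g (obsX ω)))
    (fun b => d b.2.2.1 (b.2.2.2, b.2.1, b.1))
  rw [logb_card_block] at h1
  have h2 : entropy q (fun ω => (obsX ω, obsZ ω))
      ≤ entropy q (fun ω => (obsX ω, j (obsX ω), k (obsX ω), obsZ ω, g (obsX ω))) :=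
    entropy_le_of_determined hq fun _ _ h => by
      simp only [Prod.mk.injEq] at h ⊢
      exact ⟨h.1, h.2.2.2.1⟩
  have h3 := entropy_pair_le_add_logb_card hq (fun ω => j (obsX ω))
    (fun ω => (k (obsX ω), obsZ ω, g (obsX ω)))
  have h4 := entropy_pair_le_add_logb_card hq (fun ω => g (obsX ω)) obsZ
  have h5 : entropy q (fun ω => (obsZ ω, g (obsX ω))) = entropy q (fun ω => (g (obsX ω), obsZ ω)) :=
    entropy_eq_of_determined hq fun _ _ => by simp [and_comm]
  have h6 := entropy_le_logb_card hq (fun ω => k (obsX ω))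
  have h7 := mul_le_mul_of_nonneg_right he (mul_nonneg (Nat.cast_nonneg n)
    (logb_two_natCast_nonneg (Fintype.card X)))
  have l1 := logb_card_index_le n hR
  have l2 := logb_card_index_le n hRφ
  have l3 := logb_card_index_le n hR₁
  change entropy q obsZ = _ at h0
  rw [mutualInfo]
  simp only [mul_add, mul_sub]
  linarith

/-- Achievability: for every `R ≥ 0` there are schemes with key set `[1 : 2^(n R)]` for which Bob
recovers `X^n`, with key rate close to `min R H(X)` and leakage close to `max (R - C_s) 0`. -/
lemma exists_scheme (P : DegradedSource S X Y Z) (sab se : S) {R δ : ℝ} (hR : 0 ≤ R)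
    (hδ : 0 < δ) :
    ∃ (Rφ : ℝ) (c : ∀ n, KeySystem S X Y R Rφ n), RecoversSource P sab se c ∧
      ∀ᶠ n in atTop, keyError P sab se (c n) < δ ∧
        min R (entropy (P.law sab se) (fun w => w.1)) - δ < keyRate P sab se (c n) ∧
        leakage P sab se (c n) ≤ max (R - P.Cs sab se) 0 + δ := by
  have hp := law_mem P sab se
  have hCs := Cs_eq P sab se
  have hYXY : entropy (P.law sab se) (fun w => w.2.1)
      ≤ entropy (P.law sab se) (fun w => (w.1, w.2.1)) :=
    entropy_le_of_determined hp fun _ _ h => (Prod.mk.inj h).2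
  set hXY := entropy (P.law sab se) (fun w => (w.1, w.2.1))
  set hXZ := entropy (P.law sab se) (fun w => (w.1, w.2.2))
  set hX := entropy (P.law sab se) (fun w => w.1)
  set hY := entropy (P.law sab se) (fun w => w.2.1)
  set hZ := entropy (P.law sab se) (fun w => w.2.2)
  set Cs := P.Cs sab se
  -- The auxiliary indices have just the rates that `R` lacks for Eve, respectively for a decoder
  -- knowing only the key, to recover `X^n`.
  set η := δ / 3 with hη
  set Rφ := hXY - hY + η with hRφ
  set R₁ := max (Cs - R) 0 + η with hR₁
  set R₂ := max (hX - R) 0 + η with hR₂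
  have m₁ := le_max_left (Cs - R) 0
  have m₁' := le_max_right (Cs - R) 0
  have m₂ := le_max_left (hX - R) 0
  have m₂' := le_max_right (hX - R) 0
  have e₁ : R - Cs + max (Cs - R) 0 = max (R - Cs) 0 := by
    rcases le_total R Cs with h | h
    · rw [max_eq_left (by linarith), max_eq_right (by linarith)]; ring
    · rw [max_eq_right (by linarith), max_eq_left (by linarith)]; ring
  have e₂ : hX - max (hX - R) 0 = min R hX := by
    rcases le_total R hX with h | h
    · rw [max_eq_left (by linarith), min_eq_left h]; ring
    · rw [max_eq_right (by linarith), min_eq_right h]; ring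
  have pφ : 0 ≤ Rφ := by linarith
  have p₁ : 0 ≤ R₁ := by linarith
  have p₂ : 0 ≤ R₂ := by linarith
  obtain ⟨e, he, hb⟩ := exists_binning P sab se hR pφ p₁ p₂ (by linarith) (by linarith)
    (by linarith)
  choose g k j₁ j₂ dY dZ dX EY EZ EX using hb
  refine ⟨Rφ, fun n => ⟨fun x _ => k n x, fun x _ => g n x, fun y _ φ => k n (dY n y φ)⟩,
    ⟨fun n y _ φ => dY n y φ, squeeze_zero
      (fun n => prob_nonneg (blockLaw_mem P sab se n).1 _) EY he⟩, ?_⟩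
  filter_upwards [eventually_gt_atTop 0, he.eventually (gt_mem_nhds hδ),
    (tendsto_fano_term he (Real.logb 2 (Fintype.card X))).eventually
      (gt_mem_nhds (show 0 < η by linarith))] with n hn hen hfano
  have hn' : (0 : ℝ) < n := Nat.cast_pos.2 hn
  have hf := mul_lt_mul_of_pos_right hfano hn'
  rw [add_mul, one_div_mul_cancel hn'.ne'] at hf
  refine ⟨lt_of_le_of_lt ((prob_mono (blockLaw_mem P sab se n).1 fun ω _ h h' => h (congrArg (k n) h')).trans
    (EY n)) hen, ?_, ?_⟩
  · unfold keyRate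
    rw [lt_div_iff₀ hn', ← e₂]
    have h1 := le_key_entropy P sab se p₂ (k n) (j₂ n) (dX n) (EX n)
    have h2 : (hX - max (hX - R) 0 - δ) * n < n * hX - n * R₂ - η * n := by
      rw [hR₂]
      nlinarith
    linarith
  · unfold leakage
    rw [div_le_iff₀ hn', ← e₁]
    have h1 := mutualInfo_le P sab se hR pφ p₁ (k n) (g n) (j₁ n) (dZ n) (EZ n)
    have h2 : n * (R + Rφ + R₁ - (hXZ - hZ)) + η * n = (R - Cs + max (Cs - R) 0 + δ) * n := by
      rw [hR₁, hRφ, hCs, show δ = 3 * η by rw [hη]; ring]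
      ring
    linarith

/-- The key is a function of `X^n`, so its rate is at most `H(X)`. -/
lemma keyRate_le_entropy (P : DegradedSource S X Y Z) (sab se : S) {R Rφ : ℝ} {n : ℕ} (hn : 0 < n)
    (c : KeySystem S X Y R Rφ n) :
    keyRate P sab se c ≤ entropy (P.law sab se) (fun w => w.1) := by
  rw [keyRate, div_le_iff₀ (Nat.cast_pos.2 hn), mul_comm (entropy _ _), ← entropy_blockLaw]
  exact entropy_le_of_determined (blockLaw_mem P sab se n) fun ω ω' h =>
    congrArg (fun x => c.f₁ x sab) h

end Achievability

end KeyLeak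

/-! ### The leakage threshold and the outage criterion -/

theorem theorem2 {S X Y Z : Type*} [Fintype X] [Fintype Y] [Fintype Z]
    (P : KeyLeak.DegradedSource S X Y Z) (sab se : S) (R : ℝ) (hR : 0 ≤ R) :
    (0 < R - P.Cs sab se →
      ∀ ε : ℝ, 0 < ε → ∀ (Rφ : ℝ) (c : ∀ n, KeyLeak.KeySystem S X Y R Rφ n),
        (∀ᶠ n in atTop, R - ε < KeyLeak.keyRate P sab se (c n)) →
        KeyLeak.RecoversSource P sab se c →
        (∀ᶠ n in atTop, (R - P.Cs sab se) - 2 * ε ≤ KeyLeak.leakage P sab se (c n)) ∧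
        (∃ (Rφ' : ℝ) (c' : ∀ n, KeyLeak.KeySystem S X Y R Rφ' n),
          KeyLeak.RecoversSource P sab se c' ∧
          ∀ᶠ n in atTop,
            KeyLeak.keyError P sab se (c' n) < ε ∧
            R - ε < KeyLeak.keyRate P sab se (c' n) ∧
            KeyLeak.leakage P sab se (c' n) ≤ (R - P.Cs sab se) + 2 * ε)) ∧
    (P.Cs sab se < R ↔
      ∃ r : ℝ, 0 < r ∧ ∃ ε : ℝ, 0 < ε ∧
        ∀ (Rφ : ℝ) (c : ∀ n, KeyLeak.KeySystem S X Y R Rφ n),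
          (∀ᶠ n in atTop, R - ε < KeyLeak.keyRate P sab se (c n)) →
          KeyLeak.RecoversSource P sab se c →
          ∀ᶠ n in atTop, r < KeyLeak.leakage P sab se (c n)) := by
  constructor
  · intro hRe ε hε Rφ c hrate hrec
    refine ⟨KeyLeak.eventually_le_leakage P sab se hε c hrate hrec, ?_⟩
    -- The given scheme is needed only to know that `R - ε < H(X)`.
    have hRX : R - ε < KeyLeak.entropy (P.law sab se) (fun w => w.1) := by
      obtain ⟨n, h1, h2⟩ := (hrate.and (eventually_gt_atTop 0)).exists
      exact h1.trans_le (KeyLeak.keyRate_le_entropy P sab se h2 (c n))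
    have hmin : 0 < min R (KeyLeak.entropy (P.law sab se) (fun w => w.1)) - (R - ε) :=
      sub_pos.2 (lt_min (by linarith) hRX)
    obtain ⟨Rφ', c', hrec', hc'⟩ := KeyLeak.exists_scheme P sab se hR (lt_min hε hmin)
    refine ⟨Rφ', c', hrec', hc'.mono fun n h => ⟨h.1.trans_le (min_le_left _ _), ?_, ?_⟩⟩
    · have := min_le_right ε (min R (KeyLeak.entropy (P.law sab se) (fun w => w.1)) - (R - ε))
      linarith [h.2.1]
    · have h1 := min_le_left ε (min R (KeyLeak.entropy (P.law sab se) (fun w => w.1)) - (R - ε))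
      have h2 := h.2.2
      rw [max_eq_left hRe.le] at h2
      linarith
  · constructor
    · intro hlt
      have hε : 0 < (R - P.Cs sab se) / 4 := by linarith
      refine ⟨_, hε, _, hε, fun Rφ c hrate hrec => ?_⟩
      filter_upwards [KeyLeak.eventually_le_leakage P sab se hε c hrate hrec] with n hn
      linarith
    · rintro ⟨r, hr, ε, hε, h⟩
      by_contra! hle
      -- For `R ≤ C_s` random binning gives schemes of rate `R` with arbitrarily small leakage.
      obtain ⟨Rφ, c, hrec, hc⟩ := KeyLeak.exists_scheme P sab se hR (lt_min hε hr)
      rw [min_eq_left (hle.trans (KeyLeak.Cs_le_entropy P sab se)),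
        max_eq_right (sub_nonpos.2 hle), zero_add] at hc
      obtain ⟨n, h1, h2⟩ := ((h Rφ c (hc.mono fun n h => by
        linarith [h.2.1, min_le_left ε r]) hrec).and hc).exists
      linarith [h2.2.2, min_le_right ε r]
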